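/- Work in ZFC. A relational type $\tau$ is a set $I$ of relation symbols with finite positive arities; a structure of type $\tau$ is a set $\mathcal{A}=\langle A,\langle R_i\rangle_{i\in I}\rangle$ with $A\neq\emptyset$ and $R_i$ a relation on $A$ of the arity of $i$. For a set $S$ of structures of type $\tau$, the product $\prod S$ is the structure of type $\tau$ whose universe is the set of all functions $f$ with domain $S$ such that $f(\mathcal{A})\in A$ for every $\mathcal{A}=\langle A,\dots\rangle\in S$, and whose relations are defined pointwise. An ordinal $\kappa$ *product-reflects* a class $\mathcal{C}$ of structures of the same type $\tau$ if for every $\mathcal{A}\in\mathcal{C}$ there exist a set $S$ of structures of type $\tau$ (not necessarily in $\mathcal{C}$) with $\mathcal{A}\in S$ and an elementary embedding $j:\prod(\mathcal{C}\cap V_\kappa)\to\prod S$. An ordinal $\kappa$ *witnesses $\Pi_n$-PSR* (product structural reflection) if it product-reflects every class $\mathcal{C}$ of structures of the same type that is definable by a $\Pi_n$ formula of the language of set theory with parameters in $V_\kappa$. Here $\Sigma_n$ and $\Pi_n$ refer to the Lévy hierarchy, with $\Sigma_0=\Pi_0$ the bounded formulas. For $m>0$, $C^{(m)}$ is the class of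 cardinals $\kappa$ such that $V_\kappa\preceq_{\Sigma_m}V$, i.e. $(V_\kappa,\in)$ is a $\Sigma_m$-elementary substructure of $(V,\in)$. **Proposition.** For every natural number $n$ and every ordinal $\kappa$, if $\kappa$ witnesses $\Pi_n$-PSR, then $\kappa\in C^{(n+1)}$. -/

import Mathlib

universe u

namespace PSR

open FirstOrder FirstOrder.Language
open scoped ZFSet

/-! ### The language of set theory and the Lévy hierarchy -/

/-- The only non-logical symbol of the language of set theory: a binary relation symbol. -/
inductive SetRel : ℕ → Type
  | mem : SetRel 2

/-- The first-order language of set theory. -/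
def setLang : FirstOrder.Language.{0, 0} := ⟨fun _ => Empty, SetRel⟩

/-- The universe `V` of all sets with the membership relation. -/
instance univStructure : setLang.Structure ZFSet.{u} where
  funMap f := f.elim
  RelMap | .mem => fun v => v 0 ∈ v 1

/-- A set `s` with the membership relation restricted to it. -/
instance setStructure (s : ZFSet.{u}) : setLang.Structure s where
  funMap f := f.elim
  RelMap | .mem => fun v => (v 0 : ZFSet.{u}) ∈ (v 1 : ZFSet.{u})

/-- The atomic formula `x ∈ y`. -/
def memF {α : Type} {m : ℕ} (x y : α ⊕ Fin m) : setLang.BoundedFormula α m :=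
  BoundedFormula.rel (L := setLang) SetRel.mem ![Term.var x, Term.var y]

/-- A variable seen in a context with one more bound variable. -/
def liftVar {α : Type} {m : ℕ} (x : α ⊕ Fin m) : α ⊕ Fin (m + 1) :=
  Sum.map id Fin.castSucc x

/-- Bounded formulas: all quantifiers are of the form `∀ z ∈ x` or `∃ z ∈ x`, with `z` different
from `x` (`z` is the new variable `Sum.inr (Fin.last m)`, `x` is an old one). -/
inductive IsDelta0 {α : Type} : ∀ {m : ℕ}, setLang.BoundedFormula α m → Prop
  | falsum {m : ℕ} : IsDelta0 (BoundedFormula.falsum (n := m))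
  | equal {m : ℕ} (s t : setLang.Term (α ⊕ Fin m)) : IsDelta0 (BoundedFormula.equal s t)
  | mem {m : ℕ} (x y : α ⊕ Fin m) : IsDelta0 (memF x y)
  | imp {m : ℕ} {φ ψ : setLang.BoundedFormula α m} :
      IsDelta0 φ → IsDelta0 ψ → IsDelta0 (φ.imp ψ)
  | ball {m : ℕ} (x : α ⊕ Fin m) {φ : setLang.BoundedFormula α (m + 1)} :
      IsDelta0 φ → IsDelta0 ((memF (Sum.inr (Fin.last m)) (liftVar x)).imp φ).all
  | bex {m : ℕ} (x : α ⊕ Fin m) {φ : setLang.BoundedFormula α (m + 1)} :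
      IsDelta0 φ → IsDelta0 (memF (Sum.inr (Fin.last m)) (liftVar x) ⊓ φ).ex

/-- Formulas `∃ z₁ … ∃ zₖ φ`, `k ≥ 0`, with `φ` in `P`. -/
inductive ExBlock {α : Type} (P : ∀ m : ℕ, setLang.BoundedFormula α m → Prop) :
    ∀ m : ℕ, setLang.BoundedFormula α m → Prop
  | base {m : ℕ} {φ : setLang.BoundedFormula α m} : P m φ → ExBlock P m φ
  | ex {m : ℕ} {φ : setLang.BoundedFormula α (m + 1)} :
      ExBlock P (m + 1) φ → ExBlock P m φ.ex

/-- Formulas `∀ z₁ … ∀ zₖ φ`, `k ≥ 0`, with `φ` in `P`. -/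
inductive AllBlock {α : Type} (P : ∀ m : ℕ, setLang.BoundedFormula α m → Prop) :
    ∀ m : ℕ, setLang.BoundedFormula α m → Prop
  | base {m : ℕ} {φ : setLang.BoundedFormula α m} : P m φ → AllBlock P m φ
  | all {m : ℕ} {φ : setLang.BoundedFormula α (m + 1)} :
      AllBlock P (m + 1) φ → AllBlock P m φ.all

inductive Polarity
  | sigma
  | pi

/-- The Lévy hierarchy: `Σ₀ = Π₀` are the bounded formulas, `Σₙ₊₁` formulas are blocks of
existential quantifiers in front of `Πₙ` formulas, and `Πₙ₊₁` formulas are blocks of universal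
quantifiers in front of `Σₙ` formulas. -/
def IsLevy {α : Type} : Polarity → ℕ → ∀ m : ℕ, setLang.BoundedFormula α m → Prop
  | _, 0 => fun _ φ => IsDelta0 φ
  | .sigma, n + 1 => ExBlock (IsLevy .pi n)
  | .pi, n + 1 => AllBlock (IsLevy .sigma n)

/-- `φ` is a `Σₙ` formula. -/
def IsSigma {α : Type} (n : ℕ) (φ : setLang.Formula α) : Prop := IsLevy .sigma n 0 φ

/-- `φ` is a `Πₙ` formula. -/
def IsPi {α : Type} (n : ℕ) (φ : setLang.Formula α) : Prop := IsLevy .pi n 0 φ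

/-- The class `C` is definable by a `Πₙ` formula with finitely many parameters from `P`. -/
def IsPiDefinable (n : ℕ) (P : Set ZFSet.{u}) (C : Set ZFSet.{u}) : Prop :=
  ∃ (k : ℕ) (φ : setLang.Formula (Fin (k + 1))) (p : Fin k → ZFSet.{u}),
    IsPi n φ ∧ (∀ i, p i ∈ P) ∧
      ∀ x, x ∈ C ↔ φ.Realize (Fin.cons x p : Fin (k + 1) → ZFSet.{u})

/-- `V_κ` is a `Σₙ`-elementary substructure of `V`. -/
def SigmaElementary (n : ℕ) (κ : Ordinal.{u}) : Prop :=
  ∀ (k : ℕ) (φ : setLang.Formula (Fin k)), IsSigma n φ → ∀ v : Fin k → ↥(V_ κ),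
    φ.Realize v ↔ φ.Realize (fun i => (v i : ZFSet.{u}))

/-- The class `C⁽ⁿ⁾` of cardinals (initial ordinals) `κ` such that `V_κ` is a `Σₙ`-elementary
substructure of `V`. -/
def classC (n : ℕ) : Set Ordinal.{u} :=
  {κ | κ.IsInitial ∧ SigmaElementary n κ}

/-! ### Relational structures as sets, and their products -/

/-- A relational type: a set of relation symbols, with finite positive arities. -/
structure RelType where
  symb : ZFSet.{u}
  arity : symb → ℕ
  arity_pos : ∀ i, 0 < arity i

/-- The first-order language of a relational type. -/
def RelType.lang (τ : RelType.{u}) : FirstOrder.Language.{0, u + 1} :=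
  ⟨fun _ => Empty, fun n => {i : τ.symb // τ.arity i = n}⟩

/-- Tuples as iterated Kuratowski pairs: `⟨a⟩ = a` and `⟨a₁, …, aₙ₊₁⟩ = ⟨⟨a₁, …, aₙ⟩, aₙ₊₁⟩`.
(The value for length `0` is not used.) -/
def tuple : {n : ℕ} → (Fin n → ZFSet.{u}) → ZFSet.{u}
  | 0, _ => ∅
  | 1, v => v 0
  | n + 2, v => ZFSet.pair (tuple (fun i : Fin (n + 1) => v i.castSucc)) (v (Fin.last (n + 1)))

/-- A relational structure of type `τ`: a nonempty set `dom`, and for each symbol `i` of `τ` a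
set `rel i` of tuples of length `arity i` from `dom`. -/
structure RelStruct (τ : RelType.{u}) where
  dom : ZFSet.{u}
  dom_nonempty : dom.Nonempty
  rel : τ.symb → ZFSet.{u}
  rel_sub : ∀ i, ∀ t ∈ rel i, ∃ v : Fin (τ.arity i) → ZFSet.{u}, (∀ k, v k ∈ dom) ∧ t = tuple v

/-- The structure as a set, `⟨A, ⟨R_i⟩_{i ∈ I}⟩`, where the family `⟨R_i⟩_{i ∈ I}` is the set
of ordered pairs `⟨i, R_i⟩`, `i ∈ I`. -/
noncomputable def RelStruct.code {τ : RelType.{u}} (A : RelStruct τ) : ZFSet.{u} :=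
  ZFSet.pair A.dom (ZFSet.range fun i : τ.symb => ZFSet.pair i (A.rel i))

/-- A structure of type `τ` is determined by the set that it is. -/
theorem RelStruct.code_injective {τ : RelType.{u}} :
    Function.Injective (RelStruct.code (τ := τ)) := by
  rintro ⟨A, hA, R, hR⟩ ⟨B, hB, Q, hQ⟩ h
  obtain ⟨h1, h2⟩ := ZFSet.pair_inj.1 h
  dsimp only at h1 h2
  have h3 : R = Q := by
    funext i
    have hi : ZFSet.pair (i : ZFSet.{u}) (R i) ∈
        ZFSet.range fun i : τ.symb => ZFSet.pair i (Q i) := by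
      rw [← h2]; exact ZFSet.mem_range_self i
    obtain ⟨j, hj⟩ := ZFSet.mem_range.1 hi
    obtain ⟨h4, h5⟩ := ZFSet.pair_inj.1 hj
    obtain rfl : j = i := Subtype.ext h4
    exact h5.symm
  subst h1 h3
  rfl

/-- The universe of the product `∏ S`: all functions `f` on `S` with `f(𝒜)` in the universe of
`𝒜` for every `𝒜` in `S`. -/
def Product {τ : RelType.{u}} (S : Set (RelStruct τ)) : Type (u + 1) :=
  ∀ A : S, ↥(A.1.dom)

/-- The relations of the product are defined pointwise. -/
instance productStructure {τ : RelType.{u}} (S : Set (RelStruct τ)) :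
    τ.lang.Structure (Product S) where
  funMap f := f.elim
  RelMap r v := ∀ A : S, tuple (fun k => ((v k A : ↥(A.1.dom)) : ZFSet.{u})) ∈ A.1.rel r.1

/-! ### Product structural reflection -/

/-- `C` is a class of relational structures of type `τ`. -/
def IsClassOfStructures (τ : RelType.{u}) (C : Set ZFSet.{u}) : Prop :=
  ∀ x ∈ C, ∃ A : RelStruct τ, A.code = x

/-- The structures of type `τ` in `C ∩ V_κ`. -/
def below (τ : RelType.{u}) (C : Set ZFSet.{u}) (κ : Ordinal.{u}) : Set (RelStruct τ) :=
  {A | A.code ∈ C ∧ A.code ∈ V_ κ}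

/-- `κ` product-reflects the class `C` of structures of type `τ`: for every `𝒜` in `C` there are a
set `S` of structures of type `τ` with `𝒜 ∈ S` and an elementary embedding
`∏ (C ∩ V_κ) → ∏ S`. -/
def ProductReflects (κ : Ordinal.{u}) (τ : RelType.{u}) (C : Set ZFSet.{u}) : Prop :=
  ∀ A : RelStruct τ, A.code ∈ C →
    ∃ S : Set (RelStruct τ), Small.{u} S ∧ A ∈ S ∧
      Nonempty (Product (below τ C κ) ↪ₑ[τ.lang] Product S)

/-- `κ` witnesses `Πₙ`-PSR: it product-reflects every class of relational structures of the same
type that is `Πₙ`-definable with parameters in `V_κ`. -/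
def WitnessesPiPSR (n : ℕ) (κ : Ordinal.{u}) : Prop :=
  ∀ (τ : RelType.{u}) (C : Set ZFSet.{u}),
    IsClassOfStructures τ C → IsPiDefinable n {x | x ∈ V_ κ} C → ProductReflects κ τ C

end PSR

/-! The key is the product of the empty family. Let `C` be a class of structures with one unary
relation, empty in each of them. If `C ∩ V_κ` were empty, the product over it would be a single
point, at which the relation holds vacuously. An embedding into `∏ S` with `𝒜 ∈ S` would then give a
point of `𝒜` in its empty relation. So if such a class is `Πₙ`-definable from parameters in `V_κ`
and nonempty, it meets `V_κ` (`ProductReflects.below_nonempty`).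

Coding a witness as the universe of such a structure shows that a `Πₙ` condition with parameters in
`V_κ` that has a solution has one in `V_κ` (`WitnessesPiPSR.exists_mem`). An existential block
contracts to one quantifier by pairing, and the Tarski–Vaught argument, by induction on the level,
gives `Σₙ₊₁`-elementarity.

That `κ` is a cardinal needs only bounded conditions. An injection of `κ` into some `α < κ` would
code the order of `κ` by a relation in `V_κ`. A set in `V_κ` would then map that relation into
membership, and so take values of rank at least `b` for every `b < κ`, which exceeds its own rank
(`WitnessesPiPSR.not_injective`). -/

namespace PSR

open FirstOrder FirstOrder.Language
open scoped ZFSet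

/-! ### Formulas of the Lévy hierarchy and changes of variables -/

/-- The map of variables in the scope of one more quantifier. -/
def extendVar {α β : Type} {m m' : ℕ} (g : α ⊕ Fin m → β ⊕ Fin m') :
    α ⊕ Fin (m + 1) → β ⊕ Fin (m' + 1) :=
  Sum.elim (fun a => liftVar (g (Sum.inl a)))
    (Fin.lastCases (Sum.inr (Fin.last m')) fun i => liftVar (g (Sum.inr i)))

@[simp]
theorem elim_snoc_liftVar {α : Type} {m : ℕ} {M : Type*} (v : α → M) (xs : Fin m → M) (z : M)
    (x : α ⊕ Fin m) :
    Sum.elim v (Fin.snoc xs z : Fin (m + 1) → M) (liftVar x) = Sum.elim v xs x := by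
  cases x <;> simp [liftVar]

/-- The assignment of the free variables obtained by a change of variables. -/
def pullFree {α β : Type} {m m' : ℕ} {M : Type*} (g : α ⊕ Fin m → β ⊕ Fin m')
    (v : β → M) (xs : Fin m' → M) : α → M :=
  fun a => Sum.elim v xs (g (Sum.inl a))

/-- The assignment of the bound variables obtained by a change of variables. -/
def pullBound {α β : Type} {m m' : ℕ} {M : Type*} (g : α ⊕ Fin m → β ⊕ Fin m')
    (v : β → M) (xs : Fin m' → M) : Fin m → M :=
  fun i => Sum.elim v xs (g (Sum.inr i))

theorem elim_pull {α β : Type} {m m' : ℕ} {M : Type*} (g : α ⊕ Fin m → β ⊕ Fin m')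
    (v : β → M) (xs : Fin m' → M) (x : α ⊕ Fin m) :
    Sum.elim (pullFree g v xs) (pullBound g v xs) x = Sum.elim v xs (g x) := by
  cases x <;> rfl

theorem pullFree_extendVar {α β : Type} {m m' : ℕ} {M : Type*} (g : α ⊕ Fin m → β ⊕ Fin m')
    (v : β → M) (xs : Fin m' → M) (z : M) :
    pullFree (extendVar g) v (Fin.snoc xs z : Fin (m' + 1) → M) = pullFree g v xs := by
  funext a
  simp [pullFree, extendVar]

theorem pullBound_extendVar {α β : Type} {m m' : ℕ} {M : Type*} (g : α ⊕ Fin m → β ⊕ Fin m')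
    (v : β → M) (xs : Fin m' → M) (z : M) :
    pullBound (extendVar g) v (Fin.snoc xs z : Fin (m' + 1) → M) =
      Fin.snoc (pullBound g v xs) z := by
  funext i
  induction i using Fin.lastCases <;> simp [pullBound, extendVar]

theorem realize_memF {α : Type} {m : ℕ} (x y : α ⊕ Fin m) (v : α → ZFSet.{u})
    (xs : Fin m → ZFSet.{u}) :
    (memF x y).Realize v xs ↔ Sum.elim v xs x ∈ Sum.elim v xs y :=
  Iff.rfl

theorem realize_memF_set {α : Type} {m : ℕ} {s : ZFSet.{u}} (x y : α ⊕ Fin m) (v : α → s)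
    (xs : Fin m → s) :
    (memF x y).Realize v xs ↔
      ((Sum.elim v xs x : s) : ZFSet.{u}) ∈ ((Sum.elim v xs y : s) : ZFSet.{u}) :=
  Iff.rfl

theorem exists_eq_var {β : Type} (t : setLang.Term β) : ∃ x, t = Term.var x := by
  cases t with
  | var x => exact ⟨x, rfl⟩
  | func f _ => exact f.elim

/-- `ψ` is the result of the change of variables `g` in `φ`, up to equivalence in `V`. -/
def IsSubst {α β : Type} {m m' : ℕ} (g : α ⊕ Fin m → β ⊕ Fin m')
    (φ : setLang.BoundedFormula α m) (ψ : setLang.BoundedFormula β m') : Prop :=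
  ∀ (v : β → ZFSet.{u}) (xs : Fin m' → ZFSet.{u}),
    ψ.Realize v xs ↔ φ.Realize (pullFree g v xs) (pullBound g v xs)

/-- The map `g` may exchange free and bound-context variables; this is what allows definability to
be treated through assignments alone in `LevyDef`. -/
theorem IsDelta0.exists_subst {α β : Type} {m : ℕ} {φ : setLang.BoundedFormula α m}
    (h : IsDelta0 φ) {m' : ℕ} (g : α ⊕ Fin m → β ⊕ Fin m') :
    ∃ ψ : setLang.BoundedFormula β m', IsDelta0 ψ ∧ IsSubst.{u} g φ ψ := by
  induction h generalizing m' with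
  | falsum => exact ⟨_, .falsum, fun _ _ => Iff.rfl⟩
  | equal s t =>
    obtain ⟨x, rfl⟩ := exists_eq_var s
    obtain ⟨y, rfl⟩ := exists_eq_var t
    refine ⟨_, .equal (Term.var (g x)) (Term.var (g y)), fun v xs => ?_⟩
    change Sum.elim v xs (g x) = Sum.elim v xs (g y) ↔ Sum.elim _ _ x = Sum.elim _ _ y
    rw [elim_pull, elim_pull]
  | mem x y =>
    refine ⟨_, .mem (g x) (g y), fun v xs => ?_⟩
    rw [realize_memF, realize_memF, elim_pull, elim_pull]
  | imp _ _ ih₁ ih₂ =>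
    obtain ⟨ψ₁, h₁, e₁⟩ := ih₁ g
    obtain ⟨ψ₂, h₂, e₂⟩ := ih₂ g
    exact ⟨_, h₁.imp h₂, fun v xs => imp_congr (e₁ v xs) (e₂ v xs)⟩
  | ball x _ ih =>
    obtain ⟨ψ, h, e⟩ := ih (extendVar g)
    refine ⟨_, .ball (g x) h, fun v xs => forall_congr' fun z => imp_congr ?_ ?_⟩
    · simp [realize_memF, elim_pull]
    · rw [e, pullFree_extendVar, pullBound_extendVar]
  | bex x _ ih =>
    obtain ⟨ψ, h, e⟩ := ih (extendVar g)
    refine ⟨_, .bex (g x) h, fun v xs => ?_⟩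
    simp only [BoundedFormula.realize_ex, BoundedFormula.realize_inf]
    refine exists_congr fun z => and_congr ?_ ?_
    · simp [realize_memF, elim_pull]
    · rw [e, pullFree_extendVar, pullBound_extendVar]

/-- Every formula of `P` has a change of variables in `P'`. -/
def SubstClosed {α β : Type} (P : ∀ m, setLang.BoundedFormula α m → Prop)
    (P' : ∀ m, setLang.BoundedFormula β m → Prop) : Prop :=
  ∀ ⦃m : ℕ⦄ ⦃φ : setLang.BoundedFormula α m⦄, P m φ → ∀ ⦃m' : ℕ⦄ (g : α ⊕ Fin m → β ⊕ Fin m'),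
    ∃ ψ, P' m' ψ ∧ IsSubst.{u} g φ ψ

theorem SubstClosed.exBlock {α β : Type} {P : ∀ m, setLang.BoundedFormula α m → Prop}
    {P' : ∀ m, setLang.BoundedFormula β m → Prop} (hP : SubstClosed.{u} P P') :
    SubstClosed.{u} (ExBlock P) (ExBlock P') := by
  intro m φ h
  induction h with
  | base h =>
    intro m' g
    obtain ⟨ψ, h, e⟩ := hP h g
    exact ⟨ψ, .base h, e⟩
  | ex _ ih =>
    intro m' g
    obtain ⟨ψ, h, e⟩ := ih (extendVar g)
    refine ⟨_, .ex h, fun v xs => ?_⟩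
    simp only [BoundedFormula.realize_ex]
    refine exists_congr fun z => ?_
    rw [e, pullFree_extendVar, pullBound_extendVar]

theorem SubstClosed.allBlock {α β : Type} {P : ∀ m, setLang.BoundedFormula α m → Prop}
    {P' : ∀ m, setLang.BoundedFormula β m → Prop} (hP : SubstClosed.{u} P P') :
    SubstClosed.{u} (AllBlock P) (AllBlock P') := by
  intro m φ h
  induction h with
  | base h =>
    intro m' g
    obtain ⟨ψ, h, e⟩ := hP h g
    exact ⟨ψ, .base h, e⟩
  | all _ ih =>
    intro m' g
    obtain ⟨ψ, h, e⟩ := ih (extendVar g)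
    refine ⟨_, .all h, fun v xs => ?_⟩
    simp only [BoundedFormula.realize_all]
    refine forall_congr' fun z => ?_
    rw [e, pullFree_extendVar, pullBound_extendVar]

theorem IsLevy.substClosed {α β : Type} (n : ℕ) :
    ∀ p, SubstClosed.{u} (IsLevy (α := α) p n) (IsLevy (α := β) p n) := by
  induction n with
  | zero => rintro (_ | _) m φ h m' g <;> exact IsDelta0.exists_subst h g
  | succ n ih =>
    rintro (_ | _)
    · exact (ih .pi).exBlock
    · exact (ih .sigma).allBlock

/-- The dual polarity. -/
def Polarity.dual : Polarity → Polarity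
  | .sigma => .pi
  | .pi => .sigma

theorem IsDelta0.neg {α : Type} {m : ℕ} {φ : setLang.BoundedFormula α m} (h : IsDelta0 φ) :
    IsDelta0 φ.not :=
  h.imp .falsum

theorem IsLevy.exists_not {α : Type} (n : ℕ) : ∀ (p : Polarity) {m : ℕ}
    {φ : setLang.BoundedFormula α m}, IsLevy p n m φ →
      ∃ ψ, IsLevy p.dual n m ψ ∧ ∀ (v : α → ZFSet.{u}) xs, ψ.Realize v xs ↔ ¬ φ.Realize v xs := by
  induction n with
  | zero =>
    rintro (_ | _) m φ h <;>
      exact ⟨φ.not, IsDelta0.neg h, fun _ _ => BoundedFormula.realize_not⟩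
  | succ n ih =>
    rintro (_ | _) m φ h
    · change ExBlock _ _ _ at h
      induction h with
      | base h =>
        obtain ⟨ψ, h, e⟩ := ih .pi h
        exact ⟨ψ, AllBlock.base h, e⟩
      | ex _ ih' =>
        obtain ⟨ψ, h, e⟩ := ih'
        exact ⟨ψ.all, AllBlock.all h, fun v xs => by simp [e]⟩
    · change AllBlock _ _ _ at h
      induction h with
      | base h =>
        obtain ⟨ψ, h, e⟩ := ih .sigma h
        exact ⟨ψ, ExBlock.base h, e⟩
      | all _ ih' =>
        obtain ⟨ψ, h, e⟩ := ih'
        exact ⟨ψ.ex, ExBlock.ex h, fun v xs => by simp [e]⟩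

theorem IsDelta0.inf {α : Type} {m : ℕ} {φ ψ : setLang.BoundedFormula α m} (h : IsDelta0 φ)
    (h' : IsDelta0 ψ) : IsDelta0 (φ ⊓ ψ) :=
  (h.imp h'.neg).neg

theorem IsDelta0.exists_lift {α : Type} {m : ℕ} {φ : setLang.BoundedFormula α m}
    (h : IsDelta0 φ) : ∃ ψ : setLang.BoundedFormula α (m + 1), IsDelta0 ψ ∧
      ∀ (v : α → ZFSet.{u}) xs z, ψ.Realize v (Fin.snoc xs z) ↔ φ.Realize v xs := by
  obtain ⟨ψ, h, e⟩ := h.exists_subst.{u} liftVar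
  refine ⟨ψ, h, fun v xs z => ?_⟩
  rw [e]
  have h1 : pullFree liftVar v (Fin.snoc xs z : Fin (m + 1) → ZFSet.{u}) = v := by
    funext a; simp [pullFree]
  have h2 : pullBound liftVar v (Fin.snoc xs z : Fin (m + 1) → ZFSet.{u}) = xs := by
    funext a; simp [pullBound]
  rw [h1, h2]

/-- The bounded conjunct moves inside all the quantifiers and joins the bounded matrix. Passing a
universal quantifier uses that the universe is nonempty. -/
theorem IsLevy.exists_inf {α : Type} (n : ℕ) : ∀ (p : Polarity) {m : ℕ}
    {δ φ : setLang.BoundedFormula α m}, IsDelta0 δ → IsLevy p n m φ →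
      ∃ ψ, IsLevy p n m ψ ∧
        ∀ (v : α → ZFSet.{u}) xs, ψ.Realize v xs ↔ δ.Realize v xs ∧ φ.Realize v xs := by
  induction n with
  | zero =>
    rintro (_ | _) m δ φ hδ h <;>
      exact ⟨δ ⊓ φ, IsDelta0.inf hδ h, fun _ _ => BoundedFormula.realize_inf⟩
  | succ n ih =>
    rintro (_ | _) m δ φ hδ h
    · change ExBlock _ _ _ at h
      induction h with
      | base h =>
        obtain ⟨ψ, h, e⟩ := ih .pi hδ h
        exact ⟨ψ, ExBlock.base h, e⟩
      | ex _ ih' =>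
        obtain ⟨δ', hδ', e'⟩ := hδ.exists_lift.{u}
        obtain ⟨ψ, h, e⟩ := ih' hδ'
        exact ⟨ψ.ex, ExBlock.ex h, fun v xs => by simp [e, e']⟩
    · change AllBlock _ _ _ at h
      induction h with
      | base h =>
        obtain ⟨ψ, h, e⟩ := ih .sigma hδ h
        exact ⟨ψ, AllBlock.base h, e⟩
      | all _ ih' =>
        obtain ⟨δ', hδ', e'⟩ := hδ.exists_lift.{u}
        obtain ⟨ψ, h, e⟩ := ih' hδ'
        exact ⟨ψ.all, AllBlock.all h, fun v xs => by simp [e, e', forall_and]⟩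

theorem ExBlock.mono {α : Type} {P P' : ∀ m, setLang.BoundedFormula α m → Prop}
    (hP : ∀ {m φ}, P m φ → P' m φ) {m : ℕ} {φ : setLang.BoundedFormula α m}
    (h : ExBlock P m φ) : ExBlock P' m φ := by
  induction h with
  | base h => exact .base (hP h)
  | ex _ ih => exact .ex ih

theorem AllBlock.mono {α : Type} {P P' : ∀ m, setLang.BoundedFormula α m → Prop}
    (hP : ∀ {m φ}, P m φ → P' m φ) {m : ℕ} {φ : setLang.BoundedFormula α m}
    (h : AllBlock P m φ) : AllBlock P' m φ := by
  induction h with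
  | base h => exact .base (hP h)
  | all _ ih => exact .all ih

theorem IsLevy.succ {α : Type} (n : ℕ) : ∀ (p : Polarity) {m : ℕ}
    {φ : setLang.BoundedFormula α m}, IsLevy p n m φ → IsLevy p (n + 1) m φ := by
  induction n with
  | zero =>
    rintro (_ | _) m φ h
    · exact ExBlock.base h
    · exact AllBlock.base h
  | succ n ih =>
    rintro (_ | _) m φ h
    · exact ExBlock.mono (ih .pi) h
    · exact AllBlock.mono (ih .sigma) h

theorem IsLevy.mono {α : Type} {n n' : ℕ} (hn : n ≤ n') (p : Polarity) {m : ℕ}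
    {φ : setLang.BoundedFormula α m} (h : IsLevy p n m φ) : IsLevy p n' m φ := by
  induction hn with
  | refl => exact h
  | step _ ih => exact IsLevy.succ _ _ ih

theorem WitnessesPiPSR.mono {n n' : ℕ} (hn : n ≤ n') {κ : Ordinal.{u}}
    (h : WitnessesPiPSR n' κ) : WitnessesPiPSR n κ := by
  rintro τ C hC ⟨k, φ, p, hφ, hp, e⟩
  exact h τ C hC ⟨k, φ, p, IsLevy.mono hn _ hφ, hp, e⟩

/-! ### Definable predicates on assignments -/

/-- The predicate `Q` on assignments of sets to the variables in `α` is definable in `V` by a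
formula of the Lévy hierarchy. -/
def LevyDef (p : Polarity) (n : ℕ) {α : Type} (Q : (α → ZFSet.{u}) → Prop) : Prop :=
  ∃ φ : setLang.BoundedFormula α 0, IsLevy p n 0 φ ∧ ∀ v, φ.Realize v default ↔ Q v

/-- `Q` is definable by a bounded formula. -/
abbrev BoundedDef {α : Type} (Q : (α → ZFSet.{u}) → Prop) : Prop := LevyDef .pi 0 Q

namespace LevyDef

variable {α β : Type} {p : Polarity} {n : ℕ}

theorem congr {Q Q' : (α → ZFSet.{u}) → Prop} (h : LevyDef p n Q) (e : ∀ s, Q' s ↔ Q s) :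
    LevyDef p n Q' := by
  obtain ⟨φ, hφ, e'⟩ := h
  exact ⟨φ, hφ, fun v => (e' v).trans (e v).symm⟩

theorem of_realize {m : ℕ} {φ : setLang.BoundedFormula α m} (h : IsLevy p n m φ) :
    LevyDef p n fun s : α ⊕ Fin m → ZFSet.{u} => φ.Realize (s ∘ Sum.inl) (s ∘ Sum.inr) := by
  obtain ⟨ψ, h, e⟩ := IsLevy.substClosed.{u} n p h (Sum.inl (α := α ⊕ Fin m) (β := Fin 0))
  exact ⟨ψ, h, fun v => e v _⟩

theorem exists_realize {Q : (α → ZFSet.{u}) → Prop} (h : LevyDef p n Q) {m : ℕ}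
    (g : α → β ⊕ Fin m) : ∃ ψ : setLang.BoundedFormula β m, IsLevy p n m ψ ∧
      ∀ v xs, ψ.Realize v xs ↔ Q fun a => Sum.elim v xs (g a) := by
  obtain ⟨φ, h, e⟩ := h
  obtain ⟨ψ, h, e'⟩ := IsLevy.substClosed.{u} n p h (Sum.elim g Fin.elim0)
  refine ⟨ψ, h, fun v xs => (e' v xs).trans (Iff.trans ?_ (e _))⟩
  rw [Subsingleton.elim (pullBound _ v xs) default]
  rfl

theorem subst {Q : (α → ZFSet.{u}) → Prop} (h : LevyDef p n Q) (g : α → β) :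
    LevyDef p n fun s : β → ZFSet.{u} => Q fun a => s (g a) := by
  obtain ⟨ψ, h, e⟩ := h.exists_realize (m := 0) fun a => Sum.inl (g a)
  exact ⟨ψ, h, fun v => e v _⟩

theorem neg {Q : (α → ZFSet.{u}) → Prop} (h : LevyDef p n Q) :
    LevyDef p.dual n fun s => ¬ Q s := by
  obtain ⟨φ, h, e⟩ := h
  obtain ⟨ψ, h, e'⟩ := IsLevy.exists_not.{u} n p h
  exact ⟨ψ, h, fun v => by rw [e', e]⟩

theorem bounded_and {P Q : (α → ZFSet.{u}) → Prop} (hP : BoundedDef P) (h : LevyDef p n Q) :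
    LevyDef p n fun s => P s ∧ Q s := by
  obtain ⟨φ, h, e⟩ := h
  obtain ⟨δ, hδ, e'⟩ := hP
  obtain ⟨ψ, h, e''⟩ := IsLevy.exists_inf.{u} n p hδ h
  exact ⟨ψ, h, fun v => by rw [e'', e, e']⟩

theorem bounded_imp {P Q : (α → ZFSet.{u}) → Prop} (hP : BoundedDef P) (h : LevyDef p n Q) :
    LevyDef p n fun s => P s → Q s := by
  have := (bounded_and hP h.neg).neg
  cases p <;> exact this.congr fun s => by simp

theorem falsum : BoundedDef fun _ : α → ZFSet.{u} => False :=
  ⟨_, IsDelta0.falsum, fun _ => Iff.rfl⟩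

theorem eq (a b : α) : BoundedDef fun s : α → ZFSet.{u} => s a = s b :=
  ⟨_, IsDelta0.equal (Term.var (Sum.inl a)) (Term.var (Sum.inl b)), fun _ => Iff.rfl⟩

theorem mem (a b : α) : BoundedDef fun s : α → ZFSet.{u} => s a ∈ s b :=
  ⟨_, IsDelta0.mem (Sum.inl a) (Sum.inl b), fun _ => Iff.rfl⟩

theorem not {Q : (α → ZFSet.{u}) → Prop} (h : BoundedDef Q) : BoundedDef fun s => ¬ Q s :=
  bounded_imp h falsum

theorem or {P Q : (α → ZFSet.{u}) → Prop} (hP : BoundedDef P) (h : BoundedDef Q) :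
    BoundedDef fun s => P s ∨ Q s :=
  (bounded_imp hP.not h).congr fun s => by tauto

/-- At positive levels the quantifier is treated as an unbounded one and joins the leading universal
block, so Collection is not needed. -/
theorem ball {P : ZFSet.{u} → (α → ZFSet.{u}) → Prop} (a : α)
    (h : LevyDef .pi n fun t : Option α → ZFSet.{u} => P (t none) fun b => t (some b)) :
    LevyDef .pi n fun s : α → ZFSet.{u} => ∀ z ∈ s a, P z s := by
  cases n with
  | zero =>
    obtain ⟨ψ, h, e⟩ := h.exists_realize (β := α) (m := 1) fun o => o.elim (Sum.inr 0) Sum.inl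
    refine ⟨_, IsDelta0.ball (Sum.inl a) h, fun v => forall_congr' fun z => imp_congr ?_ ?_⟩
    · exact Iff.rfl
    · exact e v _
  | succ n =>
    have h' := bounded_imp (mem none (some a)) h
    obtain ⟨ψ, h, e⟩ := h'.exists_realize (β := α) (m := 1) fun o => o.elim (Sum.inr 0) Sum.inl
    exact ⟨_, AllBlock.all h, fun v => forall_congr' fun z => e v _⟩

theorem bex {P : ZFSet.{u} → (α → ZFSet.{u}) → Prop} (a : α)
    (h : BoundedDef fun t : Option α → ZFSet.{u} => P (t none) fun b => t (some b)) :
    BoundedDef fun s : α → ZFSet.{u} => ∃ z ∈ s a, P z s :=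
  (ball (P := fun z s => ¬ P z s) a h.not).not.congr fun s => by simp

theorem eq_pair (a b c : α) :
    BoundedDef fun s : α → ZFSet.{u} => s c = ZFSet.pair (s a) (s b) := by
  -- The elements `x` and `y` are the two members `{a}` and `{a, b}` of the Kuratowski pair.
  have h : BoundedDef fun s : α → ZFSet.{u} =>
      ∃ x ∈ s c, ∃ y ∈ s c, (∀ z ∈ s c, z = x ∨ z = y) ∧
        (s a ∈ x ∧ ∀ z ∈ x, z = s a) ∧ (s a ∈ y ∧ s b ∈ y ∧ ∀ z ∈ y, z = s a ∨ z = s b) := by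
    refine bex _ (bex _ (bounded_and ?_ (bounded_and ?_ ?_)))
    · exact ball _ (or (eq none _) (eq none (some none)))
    · exact bounded_and (mem _ _) (ball _ (eq none (some (some (some a)))))
    · exact bounded_and (mem _ _) (bounded_and (mem (some (some b)) _)
        (ball _ (or (eq none (some (some (some a)))) (eq none (some (some (some b)))))))
  refine h.congr fun s => ⟨fun e => ?_, ?_⟩
  · rw [e]
    refine ⟨{s a}, ?_, {s a, s b}, ?_, ?_, ?_, ?_⟩ <;> simp [ZFSet.pair]
  · rintro ⟨x, hx, y, hy, h1, ⟨h2, h3⟩, h4, h5, h6⟩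
    have ex : x = {s a} := by
      ext z; rw [ZFSet.mem_singleton]; exact ⟨h3 z, by rintro rfl; exact h2⟩
    have ey : y = {s a, s b} := by
      ext z; rw [ZFSet.mem_pair]
      exact ⟨h6 z, by rintro (rfl | rfl) <;> assumption⟩
    ext z
    rw [ZFSet.pair, ZFSet.mem_pair, ← ex, ← ey]
    exact ⟨h1 z, by rintro (rfl | rfl) <;> assumption⟩

end LevyDef

/-- The set `w = {y, z}` makes quantification over the components of `x` bounded. -/
theorem mem_pair_components {x y z : ZFSet.{u}} (h : x = ZFSet.pair y z) :
    ∃ w ∈ x, y ∈ w ∧ z ∈ w :=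
  ⟨{y, z}, by simp [h, ZFSet.pair], by simp, by simp⟩

namespace LevyDef

variable {α : Type} {n : ℕ}

/-- Components are unique, so "some components satisfy `Q`" means that `s a` is a pair (bounded) and
that all its components satisfy `Q`. The universal form stays `Πₙ`. -/
theorem exists_pair {Q : ZFSet.{u} → ZFSet.{u} → (α → ZFSet.{u}) → Prop} (a : α)
    (h : LevyDef .pi n fun t : Option (Option α) → ZFSet.{u} =>
      Q (t none) (t (some none)) fun b => t (some (some b))) :
    LevyDef .pi n fun s : α → ZFSet.{u} => ∃ y z, s a = ZFSet.pair y z ∧ Q y z s := by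
  have h1 : BoundedDef fun s : α → ZFSet.{u} =>
      ∃ w ∈ s a, ∃ y ∈ w, ∃ z ∈ w, s a = ZFSet.pair y z :=
    bex _ (bex _ (bex _ (eq_pair (some none) none _)))
  have h2 : LevyDef .pi n fun s : α → ZFSet.{u} =>
      ∀ w ∈ s a, ∀ y ∈ w, ∀ z ∈ w, s a = ZFSet.pair y z → Q y z s := by
    refine ball _ (ball _ (ball _ (bounded_imp (eq_pair (some none) none _) ?_)))
    exact h.subst fun o => o.elim (some none) fun o => o.elim none fun b => some (some (some b))
  refine (bounded_and h1 h2).congr fun s => ⟨?_, ?_⟩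
  · rintro ⟨y, z, e, hq⟩
    obtain ⟨w, hw, hy, hz⟩ := mem_pair_components e
    refine ⟨⟨w, hw, y, hy, z, hz, e⟩, fun _ _ y' _ z' _ e' => ?_⟩
    obtain ⟨rfl, rfl⟩ := ZFSet.pair_inj.1 (e.symm.trans e')
    exact hq
  · rintro ⟨⟨w, hw, y, hy, z, hz, e⟩, h⟩
    exact ⟨y, z, e, h w hw y hy z hz e⟩

/-- A block of existential quantifiers can be contracted to a single one. -/
theorem exists_contract {m : ℕ} {φ : setLang.BoundedFormula α m}
    (h : ExBlock (IsLevy .pi n) m φ) :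
    ∃ Q : ZFSet.{u} → (α ⊕ Fin m → ZFSet.{u}) → Prop,
      (LevyDef .pi n fun t : Option (α ⊕ Fin m) → ZFSet.{u} => Q (t none) fun b => t (some b)) ∧
        ∀ v xs, φ.Realize v xs ↔ ∃ z, Q z (Sum.elim v xs) := by
  induction h with
  | base h =>
    -- An empty block needs no witness; `∅` is a dummy.
    exact ⟨fun _ s => BoundedFormula.Realize _ (s ∘ Sum.inl) (s ∘ Sum.inr),
      (of_realize h).subst some, fun v xs => ⟨fun h => ⟨∅, h⟩, fun ⟨_, h⟩ => h⟩⟩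
  | @ex m φ _ ih =>
    obtain ⟨Q, hQ, e⟩ := ih
    -- The single witness `w` pairs the outermost value `y` with the code `z` for the rest of the
    -- block.
    refine ⟨fun w s => ∃ y z, w = ZFSet.pair y z ∧ Q z (Sum.elim (s ∘ Sum.inl)
      (Fin.snoc (s ∘ Sum.inr) y)), exists_pair (α := Option (α ⊕ Fin m)) none
      (Q := fun y z t => Q z (Sum.elim (fun a => t (some (Sum.inl a)))
        (Fin.snoc (fun i => t (some (Sum.inr i))) y))) ?_, ?_⟩
    · refine (hQ.subst (β := Option (Option (Option (α ⊕ Fin m)))) fun o =>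
        o.elim (some none) (Sum.elim (fun a => some (some (some (Sum.inl a))))
          (Fin.lastCases none fun i => some (some (some (Sum.inr i)))))).congr fun s => ?_
      refine iff_of_eq (congrArg (Q _) (funext ?_))
      rintro (a | i)
      · rfl
      · induction i using Fin.lastCases <;> simp
    · intro v xs
      rw [BoundedFormula.realize_ex]
      constructor
      · rintro ⟨y, hy⟩
        obtain ⟨z, hz⟩ := (e _ _).1 hy
        exact ⟨ZFSet.pair y z, y, z, rfl, hz⟩
      · rintro ⟨_, y, z, -, hz⟩
        exact ⟨y, (e _ _).2 ⟨z, hz⟩⟩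

end LevyDef

/-! ### Reflection of witnesses -/

/-- The relational type with a single unary relation symbol, the empty set. -/
noncomputable def unaryType : RelType.{u} where
  symb := {∅}
  arity _ := 1
  arity_pos _ := Nat.one_pos

/-- The structure with universe `d` whose unary relation is empty. -/
noncomputable def emptyPredicate (d : ZFSet.{u}) (hd : d.Nonempty) : RelStruct unaryType.{u} where
  dom := d
  dom_nonempty := hd
  rel _ := ∅
  rel_sub _ t ht := (ZFSet.notMem_empty t ht).elim

/-- In `ZFSet.pair ∅ ∅` the first `∅` is the relation symbol and the second its empty
interpretation. -/
theorem code_emptyPredicate (d : ZFSet.{u}) (hd : d.Nonempty) :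
    (emptyPredicate d hd).code = ZFSet.pair d {ZFSet.pair ∅ ∅} := by
  unfold RelStruct.code
  congr 1
  ext z
  rw [ZFSet.mem_range, ZFSet.mem_singleton]
  constructor
  · rintro ⟨⟨i, hi⟩, rfl⟩
    obtain rfl : i = ∅ := ZFSet.mem_singleton.1 hi
    rfl
  · rintro rfl
    exact ⟨⟨∅, ZFSet.mem_singleton.2 rfl⟩, rfl⟩

theorem pair_nonempty (y z : ZFSet.{u}) : (ZFSet.pair y z).Nonempty :=
  ⟨{y}, by simp [ZFSet.pair]⟩

theorem boundedDef_eq_singleton_pair_empty {α : Type} (a : α) :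
    BoundedDef fun s : α → ZFSet.{u} => s a = {ZFSet.pair ∅ ∅} := by
  have h : BoundedDef fun s : α → ZFSet.{u} =>
      ∃ r ∈ s a, (∀ r' ∈ s a, r' = r) ∧
        ∃ w ∈ r, ∃ o ∈ w, r = ZFSet.pair o o ∧ ∀ x ∈ o, False := by
    refine .bex _ (.bounded_and (.ball _ (.eq none (some none))) ?_)
    exact .bex _ (.bex _ (.bounded_and (.eq_pair none none _) (.ball _ .falsum)))
  refine h.congr fun s => ⟨fun e => ?_, ?_⟩
  · refine ⟨ZFSet.pair ∅ ∅, by simp [e], by simp [e], {∅}, by simp [ZFSet.pair], ∅, by simp, rfl,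
      fun x hx => ZFSet.notMem_empty x hx⟩
  · rintro ⟨r, hr, h1, w, -, o, -, rfl, h2⟩
    obtain rfl : o = ∅ := ZFSet.eq_empty o |>.2 h2
    ext z
    rw [ZFSet.mem_singleton]
    exact ⟨h1 z, by rintro rfl; exact hr⟩

/-- If every structure of `C` has an empty unary relation and `κ` product-reflects `C`, then a
nonempty `C` meets `V_κ`: the product of the empty family has a point in the relation. -/
theorem ProductReflects.below_nonempty {κ : Ordinal.{u}} {C : Set ZFSet.{u}}
    (h : ProductReflects κ unaryType C) {A : RelStruct unaryType.{u}} (hA : A.code ∈ C)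
    (hrel : ∀ i, A.rel i = ∅) : (below unaryType C κ).Nonempty := by
  obtain ⟨S, -, hS, ⟨j⟩⟩ := h A hA
  by_contra hne
  rw [Set.not_nonempty_iff_eq_empty] at hne
  have hempty : IsEmpty (below unaryType C κ) := by rw [hne]; infer_instance
  let i : unaryType.{u}.symb := ⟨∅, ZFSet.mem_singleton.2 rfl⟩
  let r : unaryType.{u}.lang.Relations 1 := ⟨i, rfl⟩
  let x : Product (below unaryType C κ) := fun A => hempty.elim A
  have hx : Structure.RelMap r (fun _ : Fin 1 => x) := fun A => hempty.elim A
  -- Of elementarity, only the preservation of an atomic formula is used.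
  have hj := (j.map_rel r fun _ => x).2 hx ⟨A, hS⟩
  change _ ∈ A.rel i at hj
  rw [hrel] at hj
  exact ZFSet.notMem_empty _ hj

theorem pair_mem_vonNeumann {κ : Ordinal.{u}} {y z : ZFSet.{u}} (h : ZFSet.pair y z ∈ V_ κ) :
    y ∈ V_ κ ∧ z ∈ V_ κ := by
  obtain ⟨w, hw, hy, hz⟩ := mem_pair_components (x := ZFSet.pair y z) rfl
  have ht {x : ZFSet.{u}} : x ∈ V_ κ → x ⊆ V_ κ :=
    (ZFSet.isTransitive_vonNeumann κ).subset_of_mem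
  exact ⟨ht (ht h hw) hy, ht (ht h hw) hz⟩

/-- Witnesses of `Πₙ` predicates with parameters in `V_κ` can be found in `V_κ`. -/
theorem WitnessesPiPSR.exists_mem {n : ℕ} {κ : Ordinal.{u}} (h : WitnessesPiPSR n κ) {α : Type}
    [Finite α] {Q : ZFSet.{u} → ZFSet.{u} → (α → ZFSet.{u}) → Prop}
    (hQ : LevyDef .pi n fun t : Option (Option α) → ZFSet.{u} =>
      Q (t none) (t (some none)) fun b => t (some (some b)))
    {s : α → ZFSet.{u}} (hs : ∀ a, s a ∈ V_ κ) {y z : ZFSet.{u}} (hyz : Q y z s) :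
    ∃ y ∈ V_ κ, ∃ z ∈ V_ κ, Q y z s := by
  have hd : LevyDef .pi n fun t : Option (Option (Option α)) → ZFSet.{u} =>
      t (some none) = {ZFSet.pair ∅ ∅} ∧
        ∃ y z, t none = ZFSet.pair y z ∧ Q y z fun b => t (some (some (some b))) := by
    refine .bounded_and (boundedDef_eq_singleton_pair_empty _) (.exists_pair _
      (Q := fun y z t => Q y z fun b => t (some (some (some b)))) ?_)
    exact hQ.subst fun o => o.elim none fun o => o.elim (some none)
      fun b => some (some (some (some (some b))))
  have hc := LevyDef.exists_pair (α := Option α) none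
    (Q := fun d e t => e = {ZFSet.pair ∅ ∅} ∧
      ∃ y z, d = ZFSet.pair y z ∧ Q y z fun b => t (some b)) hd
  -- The universe `d` is the pair of witnesses itself: it is automatically nonempty, and
  -- transitivity of `V_κ` recovers `y` and `z` from it.
  let C : Set ZFSet.{u} := {x | ∃ d e, x = ZFSet.pair d e ∧
    e = {ZFSet.pair ∅ ∅} ∧ ∃ y z, d = ZFSet.pair y z ∧ Q y z s}
  have hC : IsClassOfStructures unaryType C := by
    rintro x ⟨d, e, rfl, rfl, y, z, rfl, -⟩
    exact ⟨emptyPredicate _ (pair_nonempty y z), code_emptyPredicate _ _⟩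
  have hdef : IsPiDefinable n {x | x ∈ V_ κ} C := by
    obtain ⟨k, ⟨f⟩⟩ := Finite.exists_equiv_fin α
    obtain ⟨φ, hφ, e⟩ := hc.subst (β := Fin (k + 1)) fun o => o.elim 0 fun a => (f a).succ
    refine ⟨k, φ, fun i => s (f.symm i), hφ, fun i => hs _, fun x => ?_⟩
    rw [← Formula.boundedFormula_realize_eq_realize φ _ default, e]
    simp only [C, Set.mem_ofPred_eq, Option.elim, Fin.cons_zero, Fin.cons_succ,
      Equiv.symm_apply_apply]
  have hA : (emptyPredicate _ (pair_nonempty y z)).code ∈ C :=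
    ⟨_, _, code_emptyPredicate _ _, rfl, y, z, rfl, hyz⟩
  obtain ⟨B, hB, hBκ⟩ := (h unaryType C hC hdef).below_nonempty hA fun _ => rfl
  obtain ⟨d, e, hx, -, y, z, rfl, hq⟩ := hB
  rw [hx] at hBκ
  obtain ⟨hy, hz⟩ := pair_mem_vonNeumann (pair_mem_vonNeumann hBκ).1
  exact ⟨y, hy, z, hz, hq⟩

/-- The case of a single witness. -/
theorem WitnessesPiPSR.exists_mem_single {n : ℕ} {κ : Ordinal.{u}} (h : WitnessesPiPSR n κ)
    {α : Type} [Finite α] {Q : ZFSet.{u} → (α → ZFSet.{u}) → Prop}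
    (hQ : LevyDef .pi n fun t : Option α → ZFSet.{u} => Q (t none) fun b => t (some b))
    {s : α → ZFSet.{u}} (hs : ∀ a, s a ∈ V_ κ) {y : ZFSet.{u}} (hy : Q y s) :
    ∃ y ∈ V_ κ, Q y s := by
  obtain ⟨y, hy, -, -, hq⟩ := h.exists_mem (Q := fun y _ s => Q y s)
    (hQ.subst fun o => o.elim none fun b => some (some b)) hs (z := ∅) hy
  exact ⟨y, hy, hq⟩

/-! ### Elementarity -/

/-- `φ` is absolute between `V_κ` and `V`. -/
def IsAbsolute (κ : Ordinal.{u}) {α : Type} {m : ℕ} (φ : setLang.BoundedFormula α m) : Prop :=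
  ∀ (v : α → ↥(V_ κ)) (xs : Fin m → ↥(V_ κ)),
    φ.Realize v xs ↔ φ.Realize (fun a => (v a : ZFSet.{u})) (fun i => (xs i : ZFSet.{u}))

theorem elim_coe {s : ZFSet.{u}} {α β : Type} (v : α → s) (w : β → s) (x : α ⊕ β) :
    ((Sum.elim v w x : s) : ZFSet.{u}) =
      Sum.elim (fun a => (v a : ZFSet.{u})) (fun b => (w b : ZFSet.{u})) x := by
  cases x <;> rfl

theorem snoc_coe {s : ZFSet.{u}} {m : ℕ} (xs : Fin m → s) (z : s) :
    (fun i => ((Fin.snoc xs z : Fin (m + 1) → s) i : ZFSet.{u})) =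
      Fin.snoc (fun i => (xs i : ZFSet.{u})) (z : ZFSet.{u}) := by
  funext i
  induction i using Fin.lastCases <;> simp

theorem isAbsolute_memF (κ : Ordinal.{u}) {α : Type} {m : ℕ} (x y : α ⊕ Fin m) :
    IsAbsolute κ (memF x y) := by
  intro v xs
  rw [realize_memF, realize_memF_set, elim_coe, elim_coe]

/-- `V_κ` is transitive, so a quantifier bounded by an element of `V_κ` has the same range there as
in `V`. -/
theorem IsDelta0.isAbsolute (κ : Ordinal.{u}) {α : Type} {m : ℕ}
    {φ : setLang.BoundedFormula α m} (h : IsDelta0 φ) : IsAbsolute κ φ := by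
  have ht {x : ZFSet.{u}} : x ∈ V_ κ → x ⊆ V_ κ :=
    (ZFSet.isTransitive_vonNeumann κ).subset_of_mem
  induction h with
  | falsum => exact fun _ _ => Iff.rfl
  | equal s t =>
    intro v xs
    obtain ⟨x, rfl⟩ := exists_eq_var s
    obtain ⟨y, rfl⟩ := exists_eq_var t
    change Sum.elim v xs x = Sum.elim v xs y ↔ Sum.elim _ _ x = Sum.elim _ _ y
    rw [← elim_coe, ← elim_coe, Subtype.ext_iff]
  | mem x y => exact isAbsolute_memF κ x y
  | imp _ _ ih₁ ih₂ => exact fun v xs => imp_congr (ih₁ v xs) (ih₂ v xs)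
  | @ball m x φ _ ih =>
    intro v xs
    simp only [BoundedFormula.realize_all, BoundedFormula.realize_imp]
    constructor
    · intro h z hz
      have hzx := hz
      rw [realize_memF, elim_snoc_liftVar, ← elim_coe] at hzx
      simp only [Sum.elim_inr, Fin.snoc_last] at hzx
      have := h ⟨z, ht (Sum.elim v xs x).2 hzx⟩
      rw [isAbsolute_memF, ih, snoc_coe] at this
      exact this hz
    · intro h z
      rw [isAbsolute_memF, ih, snoc_coe]
      exact h z
  | @bex m x φ _ ih =>
    intro v xs
    simp only [BoundedFormula.realize_ex, BoundedFormula.realize_inf]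
    constructor
    · rintro ⟨z, hz⟩
      rw [isAbsolute_memF, ih, snoc_coe] at hz
      exact ⟨z, hz⟩
    · rintro ⟨z, hz⟩
      have hzx := hz.1
      rw [realize_memF, elim_snoc_liftVar, ← elim_coe] at hzx
      simp only [Sum.elim_inr, Fin.snoc_last] at hzx
      refine ⟨⟨z, ht (Sum.elim v xs x).2 hzx⟩, ?_⟩
      rw [isAbsolute_memF, ih, snoc_coe]
      exact hz

/-- A true existential statement whose matrix is `Σₙ₊₁` has a witness in `V_κ`. -/
theorem WitnessesPiPSR.exists_mem_of_exBlock {n : ℕ} {κ : Ordinal.{u}} (h : WitnessesPiPSR n κ)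
    {α : Type} [Finite α] {m : ℕ} {φ : setLang.BoundedFormula α (m + 1)}
    (hφ : ExBlock (IsLevy .pi n) (m + 1) φ) {v : α → ZFSet.{u}} {xs : Fin m → ZFSet.{u}}
    (hv : ∀ a, v a ∈ V_ κ) (hxs : ∀ i, xs i ∈ V_ κ) {y : ZFSet.{u}}
    (hy : φ.Realize v (Fin.snoc xs y)) : ∃ y ∈ V_ κ, φ.Realize v (Fin.snoc xs y) := by
  obtain ⟨Q, hQ, e⟩ := LevyDef.exists_contract.{u} hφ
  obtain ⟨z, hz⟩ := (e _ _).1 hy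
  have hs : ∀ x, Sum.elim v xs x ∈ V_ κ := by
    rintro (a | i)
    exacts [hv a, hxs i]
  have hQ' : LevyDef .pi n fun t : Option (Option (α ⊕ Fin m)) → ZFSet.{u} =>
      Q (t (some none)) (Sum.elim (fun a => t (some (some (Sum.inl a))))
        (Fin.snoc (fun i => t (some (some (Sum.inr i)))) (t none))) := by
    refine (hQ.subst fun o => o.elim (some none) (Sum.elim (fun a => some (some (Sum.inl a)))
      (Fin.lastCases none fun i => some (some (Sum.inr i))))).congr fun s => ?_
    refine iff_of_eq (congrArg (Q _) (funext ?_))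
    rintro (a | i)
    · rfl
    · induction i using Fin.lastCases <;> simp
  -- Here `y` is the value wanted and `z` codes the existential block of `φ`; `z` is reflected too,
  -- but its membership in `V_κ` is discarded.
  obtain ⟨y, hy, z, -, hz⟩ := h.exists_mem
    (Q := fun y z s => Q z (Sum.elim (s ∘ Sum.inl) (Fin.snoc (s ∘ Sum.inr) y))) hQ' hs hz
  exact ⟨y, hy, (e _ _).2 ⟨z, hz⟩⟩

/-- Tarski–Vaught: only the passage from `V` down to `V_κ` uses reflection. -/
theorem WitnessesPiPSR.isAbsolute_of_exBlock {n : ℕ} {κ : Ordinal.{u}} (h : WitnessesPiPSR n κ)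
    {α : Type} [Finite α]
    (hpi : ∀ {m : ℕ} {φ : setLang.BoundedFormula α m}, IsLevy .pi n m φ → IsAbsolute κ φ)
    {m : ℕ} {φ : setLang.BoundedFormula α m} (hφ : ExBlock (IsLevy .pi n) m φ) :
    IsAbsolute κ φ := by
  induction hφ with
  | base hφ => exact hpi hφ
  | ex hφ ih =>
    intro v xs
    simp only [BoundedFormula.realize_ex]
    constructor
    · rintro ⟨z, hz⟩
      rw [ih, snoc_coe] at hz
      exact ⟨z, hz⟩
    · rintro ⟨z, hz⟩
      obtain ⟨y, hy, hz⟩ := h.exists_mem_of_exBlock hφ (fun a => (v a).2) (fun i => (xs i).2) hz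
      refine ⟨⟨y, hy⟩, ?_⟩
      rw [ih, snoc_coe]
      exact hz

theorem WitnessesPiPSR.isAbsolute_of_allBlock {n : ℕ} {κ : Ordinal.{u}} (h : WitnessesPiPSR n κ)
    {α : Type} [Finite α]
    (hsigma : ∀ {m : ℕ} {φ : setLang.BoundedFormula α m}, IsLevy .sigma n m φ → IsAbsolute κ φ)
    {m : ℕ} {φ : setLang.BoundedFormula α m} (hφ : AllBlock (IsLevy .sigma n) m φ) :
    IsAbsolute κ φ := by
  induction hφ with
  | base hφ => exact hsigma hφ
  | all hφ ih =>
    intro v xs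
    simp only [BoundedFormula.realize_all]
    constructor
    · intro hz z
      by_contra hn
      -- The negated matrix is `Σₙ₊₁`, so a counterexample in `V` yields one in `V_κ`.
      obtain ⟨ψ, hψ, e⟩ := IsLevy.exists_not.{u} (n + 1) .pi hφ
      obtain ⟨y, hy, hz'⟩ := h.exists_mem_of_exBlock hψ (fun a => (v a).2) (fun i => (xs i).2)
        ((e _ _).2 hn)
      have := hz ⟨y, hy⟩
      rw [ih, snoc_coe] at this
      exact (e _ _).1 hz' this
    · intro hz z
      rw [ih, snoc_coe]
      exact hz z

theorem WitnessesPiPSR.isAbsolute {n : ℕ} {κ : Ordinal.{u}} (h : WitnessesPiPSR n κ)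
    {α : Type} [Finite α] {j : ℕ} (hj : j ≤ n + 1) : ∀ (p : Polarity) {m : ℕ}
    {φ : setLang.BoundedFormula α m}, IsLevy p j m φ → IsAbsolute κ φ := by
  induction j with
  | zero => rintro (_ | _) m φ hφ <;> exact IsDelta0.isAbsolute κ hφ
  | succ j ih =>
    -- Level `j + 1` only needs reflection of `Πⱼ` classes, and `j ≤ n`.
    have hj' := h.mono (Nat.le_of_succ_le_succ hj)
    have ih := ih (Nat.le_of_succ_le hj)
    rintro (_ | _) m φ hφ
    · exact hj'.isAbsolute_of_exBlock (ih .pi) hφ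
    · exact hj'.isAbsolute_of_allBlock (ih .sigma) hφ

theorem WitnessesPiPSR.sigmaElementary {n : ℕ} {κ : Ordinal.{u}} (h : WitnessesPiPSR n κ) :
    SigmaElementary (n + 1) κ := by
  intro k φ hφ v
  refine (h.isAbsolute le_rfl .sigma hφ v default).trans (iff_of_eq ?_)
  rw [Formula.Realize, Subsingleton.elim (fun i => ((default : Fin 0 → ↥(V_ κ)) i : ZFSet.{u}))]

/-! ### Initial ordinals -/

/-- The condition `V_a ∈ y` has the solution `{V_a}`, hence one in `V_κ`; the rank of that one lies
strictly between `a` and `κ`. -/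
theorem WitnessesPiPSR.succ_lt {n : ℕ} {κ : Ordinal.{u}} (h : WitnessesPiPSR n κ)
    {a : Ordinal.{u}} (ha : a < κ) : Order.succ a < κ := by
  obtain ⟨y, hy, hq⟩ := (h.mono n.zero_le).exists_mem_single (α := Unit)
    (Q := fun y s => s () ∈ y) (.mem _ _) (s := fun _ => V_ a)
    (fun _ => ZFSet.vonNeumann_mem_of_lt ha) (y := {V_ a}) (ZFSet.mem_singleton.2 rfl)
  have := ZFSet.rank_lt_of_mem hq
  rw [ZFSet.rank_vonNeumann] at this
  exact (Order.succ_le_of_lt this).trans_lt (ZFSet.mem_vonNeumann.1 hy)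

/-- `f` is total on `X` and sends `R` to the membership relation. -/
def IsMemHom (X R f : ZFSet.{u}) : Prop :=
  (∀ a ∈ X, ∃ q ∈ f, ∃ w ∈ q, ∃ b ∈ w, q = ZFSet.pair a b) ∧
    ∀ q ∈ f, ∀ w ∈ q, ∀ a ∈ w, ∀ b ∈ w, q = ZFSet.pair a b →
      ∀ q' ∈ f, ∀ w' ∈ q', ∀ a' ∈ w', ∀ b' ∈ w', q' = ZFSet.pair a' b' →
        ∀ r ∈ R, r = ZFSet.pair a a' → b ∈ b'

theorem boundedDef_isMemHom {α : Type} (x r f : α) :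
    BoundedDef fun s : α → ZFSet.{u} => IsMemHom (s x) (s r) (s f) := by
  refine .bounded_and ?_ ?_
  · exact .ball _ (.bex (some f) (.bex none (.bex none
      (.eq_pair (some (some (some none))) none (some (some none))))))
  · refine .ball _ (.ball none (.ball none (.ball (some none) (.bounded_imp
      (.eq_pair (some none) none _) ?_))))
    refine .ball (some (some (some (some f)))) (.ball none (.ball none (.ball (some none)
      (.bounded_imp (.eq_pair (some none) none _) ?_))))
    refine .ball (some (some (some (some (some (some (some (some r))))))))
      (.bounded_imp (.eq_pair _ _ _) (.mem _ _))

/-- The sets `w` and `w'` in `IsMemHom` serve only to bound the quantifiers over components, and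
drop out here. -/
theorem isMemHom_iff {X R f : ZFSet.{u}} : IsMemHom X R f ↔
    (∀ a ∈ X, ∃ b, ZFSet.pair a b ∈ f) ∧
      ∀ a b a' b', ZFSet.pair a b ∈ f → ZFSet.pair a' b' ∈ f → ZFSet.pair a a' ∈ R → b ∈ b' := by
  constructor
  · rintro ⟨h1, h2⟩
    refine ⟨fun a ha => ?_, fun a b a' b' hq hq' hr => ?_⟩
    · obtain ⟨_, hq, -, -, b, -, rfl⟩ := h1 a ha
      exact ⟨b, hq⟩
    · obtain ⟨w, hw, ha, hb⟩ := mem_pair_components (x := ZFSet.pair a b) rfl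
      obtain ⟨w', hw', ha', hb'⟩ := mem_pair_components (x := ZFSet.pair a' b') rfl
      exact h2 _ hq w hw a ha b hb rfl _ hq' w' hw' a' ha' b' hb' rfl _ hr rfl
  · rintro ⟨h1, h2⟩
    refine ⟨fun a ha => ?_, ?_⟩
    · obtain ⟨b, hb⟩ := h1 a ha
      obtain ⟨w, hw, ha, hb'⟩ := mem_pair_components (x := ZFSet.pair a b) rfl
      exact ⟨_, hb, w, hw, b, hb', rfl⟩
    · rintro _ hq - - a - b - rfl _ hq' - - a' - b' - rfl _ hr rfl
      exact h2 a b a' b' hq hq' hr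

theorem WitnessesPiPSR.not_injective {n : ℕ} {κ α : Ordinal.{u}} (h : WitnessesPiPSR n κ)
    (hα : α < κ) (g : Set.Iio κ → Set.Iio α) : ¬ Function.Injective g := by
  intro hg
  let c : Set.Iio κ → ZFSet.{u} := fun b => (g b).1.toZFSet
  have hc : Function.Injective c := fun a b e =>
    hg (Subtype.ext (Ordinal.toZFSet_injective e))
  have hcα (b) : (c b).rank < α := by rw [Ordinal.rank_toZFSet]; exact (g b).2
  -- `X` and `R` are the copy along `g` of `κ` with its order, while `f` is the inverse of that
  -- copying, with values the von Neumann ordinals below `κ`.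
  let X : ZFSet.{u} := ZFSet.range c
  let R : ZFSet.{u} := ZFSet.range fun p : {p : Set.Iio κ × Set.Iio κ // p.1 < p.2} =>
    ZFSet.pair (c p.1.1) (c p.1.2)
  let f : ZFSet.{u} := ZFSet.range fun b : Set.Iio κ => ZFSet.pair (c b) b.1.toZFSet
  have hX : X ∈ V_ κ := by
    rw [ZFSet.mem_vonNeumann]
    refine lt_of_le_of_lt (ZFSet.rank_le_iff.2 ?_) hα
    intro y hy
    obtain ⟨b, rfl⟩ := ZFSet.mem_range.1 hy
    exact hcα b
  have hR : R ∈ V_ κ := by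
    rw [ZFSet.mem_vonNeumann]
    -- Pairs of sets of rank below `α` have rank below `α + 2`.
    refine lt_of_le_of_lt (ZFSet.rank_le_iff.2 ?_) (h.succ_lt (h.succ_lt hα))
    intro y hy
    obtain ⟨⟨⟨b, b'⟩, -⟩, rfl⟩ := ZFSet.mem_range.1 hy
    have h1 := hcα b
    have h2 := hcα b'
    simp only [ZFSet.pair, ZFSet.rank_pair, ZFSet.rank_singleton, max_lt_iff,
      Order.succ_lt_succ_iff]
    exact ⟨h1, h1, h2⟩
  have hf : IsMemHom X R f := by
    rw [isMemHom_iff]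
    refine ⟨fun a ha => ?_, fun a b a' b' hq hq' hr => ?_⟩
    · obtain ⟨b, rfl⟩ := ZFSet.mem_range.1 ha
      exact ⟨_, ZFSet.mem_range_self b⟩
    · obtain ⟨d, hd⟩ := ZFSet.mem_range.1 hq
      obtain ⟨d', hd'⟩ := ZFSet.mem_range.1 hq'
      obtain ⟨⟨⟨d₁, d₁'⟩, hlt⟩, hr⟩ := ZFSet.mem_range.1 hr
      obtain ⟨rfl, rfl⟩ := ZFSet.pair_inj.1 hd
      obtain ⟨rfl, rfl⟩ := ZFSet.pair_inj.1 hd'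
      obtain ⟨e, e'⟩ := ZFSet.pair_inj.1 hr
      obtain rfl := hc e
      obtain rfl := hc e'
      exact Ordinal.toZFSet_mem_toZFSet_iff.2 hlt
  -- `f` has values of every rank below `κ` and is too large for `V_κ`; `X` and `R` are small enough
  -- to be parameters, so some `F` in `V_κ` does the same work.
  obtain ⟨F, hFκ, hF⟩ := (h.mono n.zero_le).exists_mem_single (α := Bool)
    (Q := fun F s => IsMemHom (s true) (s false) F) (boundedDef_isMemHom _ _ _)
    (s := fun b => cond b X R) (by rintro (_ | _) <;> assumption) (y := f) hf
  obtain ⟨h1, h2⟩ := isMemHom_iff.1 hF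
  -- `F` need not be single-valued, so the induction bounds the rank of every value at `c b`.
  have key (b : Set.Iio κ) : ∀ y, ZFSet.pair (c b) y ∈ F → b.1 ≤ y.rank := by
    induction b using WellFoundedLT.induction with
    | ind b ih =>
      intro y hy
      refine le_of_forall_lt fun d hd => ?_
      let d' : Set.Iio κ := ⟨d, hd.trans b.2⟩
      obtain ⟨y', hy'⟩ := h1 (c d') (ZFSet.mem_range_self d')
      have hmem := h2 _ _ _ _ hy' hy (ZFSet.mem_range_self
        (⟨(d', b), hd⟩ : {p : Set.Iio κ × Set.Iio κ // p.1 < p.2}))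
      exact (ih d' hd y' hy').trans_lt (ZFSet.rank_lt_of_mem hmem)
  -- At this `b` a value must have rank at least that of `F`, yet it is a component of an element of
  -- `F`.
  let b : Set.Iio κ := ⟨F.rank, ZFSet.mem_vonNeumann.1 hFκ⟩
  obtain ⟨y, hy⟩ := h1 (c b) (ZFSet.mem_range_self b)
  obtain ⟨w, hw, -, hyw⟩ := mem_pair_components (x := ZFSet.pair (c b) y) rfl
  exact absurd (key b y hy) (not_le.2 (((ZFSet.rank_lt_of_mem hyw).trans
    (ZFSet.rank_lt_of_mem hw)).trans (ZFSet.rank_lt_of_mem hy)))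

theorem WitnessesPiPSR.isInitial {n : ℕ} {κ : Ordinal.{u}} (h : WitnessesPiPSR n κ) :
    κ.IsInitial := by
  refine le_antisymm (Cardinal.ord_card_le κ) (not_lt.1 fun hlt => ?_)
  have hcard : Cardinal.mk (Set.Iio κ) ≤ Cardinal.mk (Set.Iio κ.card.ord) := by
    rw [Cardinal.mk_Iio_ordinal, Cardinal.mk_Iio_ordinal, Cardinal.card_ord]
  obtain ⟨g⟩ := hcard
  exact h.not_injective hlt g g.injective

end PSR

theorem proposition5p1 (n : ℕ) (κ : Ordinal.{u}) (h : PSR.WitnessesPiPSR n κ) :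
    κ ∈ PSR.classC (n + 1) :=
  ⟨h.isInitial, h.sigmaElementary⟩
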